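/- All graphs are simple and undirected. A graph is \emph{CIS} if every maximal (by inclusion) clique and every maximal stable set of it intersect. It is \emph{vertex-transitive} if for every pair of vertices some automorphism maps one to the other. It is a \emph{Cayley graph} if it is isomorphic to a graph whose vertex set is a group $G$ and in which $g,h$ are adjacent if and only if $g^{-1}h\in S$, for some inverse-closed subset $S\subseteq G$ with $1\notin S$. For $n\ge 3$, let $PX(n)$ be the graph with vertex set $\mathbb{Z}_n\times\mathbb{Z}_2\times\mathbb{Z}_2$ and edge set $\{\{(i,x,y),(i+1,y,z)\} : i\in\mathbb{Z}_n,\ x,y,z\in\mathbb{Z}_2\}$, and let $Q_n$ be the graph obtained from $PX(n)$ by adding all edges $\{(i,x,y),(i,u,v)\}$ with $i\in\mathbb{Z}_n$, $x,y,u,v\in\mathbb{Z}_2$ and $(x,y)\ne(u,v)$. Proposition. Let $n\ge 4$. Then $Q_n$ is a connected vertex-transitive CIS graph of order $4n$ in which every vertex has exactly $7$ neighbors (that is, of valency $7$); its stability number (maximum size of a stable set) is $\alpha(Q_n)=n$ and its clique number is $\omega(Q_n)=4$. Moreover, if $n$ is prime then $Q_n$ is not a Cayley graph. -/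

import Mathlib

namespace CISGraphs

universe u

/-- A graph is CIS if every maximal clique and every maximal stable set intersect. -/
def IsCIS {V : Type u} (G : SimpleGraph V) : Prop :=
  ∀ C S : Set V, Maximal G.IsClique C → Maximal G.IsIndepSet S → (C ∩ S).Nonempty

/-- A graph is vertex-transitive if, for every pair of vertices, some automorphism of the graph
maps one to the other. -/
def IsVertexTransitive {V : Type u} (G : SimpleGraph V) : Prop :=
  ∀ v w : V, ∃ φ : G ≃g G, φ v = w

/-- Every vertex of the graph has exactly `k` neighbors (here `k` is meant to be positive, so that
the junk value `0` of `Set.ncard` on infinite sets plays no role). -/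
def HasValency {V : Type u} (G : SimpleGraph V) (k : ℕ) : Prop :=
  ∀ v : V, (G.neighborSet v).ncard = k

/-- A graph is Cayley if it is isomorphic to the Cayley graph of some group `A` with respect to
some inverse-closed connection set `S` not containing the identity.  An isomorphism makes `A`
equinumerous with the vertex set, so restricting `A` to the universe of `V` loses nothing. -/
def IsCayley {V : Type u} (G : SimpleGraph V) : Prop :=
  ∃ (A : Type u) (_ : Group A) (S : Set A),
    (∀ s ∈ S, s⁻¹ ∈ S) ∧ (1 : A) ∉ S ∧ Nonempty (G ≃g SimpleGraph.mulCayley S)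

/-- For such a connection set, `g` and `h` are adjacent in the Cayley graph
if and only if `g⁻¹ * h ∈ S`. -/
theorem mulCayley_adj_iff {A : Type u} [Group A] {S : Set A} (hS : ∀ s ∈ S, s⁻¹ ∈ S)
    (h1 : (1 : A) ∉ S) (g h : A) : (SimpleGraph.mulCayley S).Adj g h ↔ g⁻¹ * h ∈ S := by
  rw [SimpleGraph.mulCayley_adj']
  constructor
  · rintro ⟨-, s, hs, rfl | rfl⟩
    · simpa using hs
    · simpa using hS s hs
  · intro hs
    refine ⟨?_, _, hs, Or.inl (by simp)⟩
    rintro rfl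
    exact h1 (by simpa using hs)

/-- The Praeger–Xu graph `PX(n)` (for `n ≥ 3`): the vertex set is `ℤ_n × ℤ_2 × ℤ_2` and the edges
are the pairs `{(i, x, y), (i + 1, y, z)}`. -/
def PX (n : ℕ) : SimpleGraph (ZMod n × ZMod 2 × ZMod 2) :=
  SimpleGraph.fromRel fun v w =>
    ∃ (i : ZMod n) (x y z : ZMod 2), v = (i, x, y) ∧ w = (i + 1, y, z)

/-- The graph `Q_n` (for `n ≥ 3`), obtained from `PX(n)` by adding all edges
`{(i, x, y), (i, u, v)}` with `(x, y) ≠ (u, v)`. -/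
def Q (n : ℕ) : SimpleGraph (ZMod n × ZMod 2 × ZMod 2) :=
  PX n ⊔ SimpleGraph.fromRel fun v w =>
    ∃ (i : ZMod n) (p q : ZMod 2 × ZMod 2), p ≠ q ∧ v = (i, p) ∧ w = (i, q)

end CISGraphs

/-!
The graph `Q n` is a cycle of `n` cliques of size four, the fibers, and for `4 ≤ n` an edge between
two fibers lies in a unique maximal clique, a junction formed by half of each of them. A stable set
meets every fiber at most once. A maximal one, `S`, meets the `i`-th fiber exactly once: the at most
one vertex of `S` in the fiber `i - 1` rules out one value of `x` in `(i, x, y)`, the one in the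
fiber `i + 1` rules out one value of `y`, and if `S` missed the fiber `i` it could be extended by a
vertex avoiding both values. The representatives of two consecutive fibers are nonadjacent, so `S`
meets every junction between these fibers.

The common neighbors of the ends of an edge between two fibers form a clique, while those of two
vertices of a fiber that share exactly one bit do not. Hence automorphisms permute the fibers,
acting on them as rotations and reflections of an `n`-cycle. If `Q n` is a Cayley graph of a group
`A` of order `4 * n` and `n` is coprime to `6`, then Burnside's transfer theorem gives a normal
complement `N` of a Sylow 2-subgroup, and `N` acts regularly on the fibers. The element `g` of `N`
that rotates them by one step is conjugate only to itself and its inverse, so left multiplication by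
`g` moves either every vertex or no vertex to a neighbor. But an automorphism of `Q n` that rotates
the fibers by one step moves some vertices of each fiber to neighbors and others to non-neighbors.
-/

namespace CISGraphs

variable {n : ℕ}

section Cycle

theorem two_ne_zero_zmod (hn : 3 ≤ n) : (2 : ZMod n) ≠ 0 := by
  exact_mod_cast (ZMod.natCast_eq_zero_iff 2 n).not.2 (Nat.not_dvd_of_pos_of_lt two_pos hn)

theorem three_ne_zero_zmod (hn : 4 ≤ n) : (3 : ZMod n) ≠ 0 := by
  exact_mod_cast (ZMod.natCast_eq_zero_iff 3 n).not.2 (Nat.not_dvd_of_pos_of_lt three_pos hn)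

theorem apply_eq_apply_zero_of_periodic_one {α : Type*} {f : ZMod n → α}
    (hf : Function.Periodic f 1) (i : ZMod n) : f i = f 0 := by
  obtain ⟨k, rfl⟩ := ZMod.intCast_surjective i
  simpa only [mul_one] using hf.int_mul_eq k

theorem coprime_six_of_prime (hn : 4 ≤ n) (hp : n.Prime) : n.Coprime 6 := by
  rw [hp.coprime_iff_not_dvd]
  intro h
  have hle : n ≤ 6 := Nat.le_of_dvd (by norm_num) h
  interval_cases n <;> revert h hp <;> norm_num

/-- A permutation of `ZMod n` is dihedral if it is a rotation or a reflection of the cycle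
`0, 1, …, n - 1`. -/
def IsDihedral (σ : Equiv.Perm (ZMod n)) : Prop :=
  (∃ c, ∀ i, σ i = c + i) ∨ ∃ c, ∀ i, σ i = c - i

theorem isDihedral_of_apply_add_one {σ : Equiv.Perm (ZMod n)}
    (hσ : ∀ i, σ (i + 1) = σ i + 1 ∨ σ (i + 1) = σ i - 1) :
    IsDihedral σ := by
  have hstep : Function.Periodic (fun i => σ (i + 1) - σ i) 1 := fun i => by
    by_cases h2 : (2 : ZMod n) = 0
    · grind
    · have hback : σ (i + 1 + 1) ≠ σ i :=
        σ.injective.ne fun h => h2 (by linear_combination h)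
      grind
  have hlin : Function.Periodic (fun i => σ i - i * (σ 1 - σ 0)) 1 := fun i => by
    have := apply_eq_apply_zero_of_periodic_one hstep i
    rw [zero_add] at this
    linear_combination this
  have hformula (i : ZMod n) : σ i = σ 0 + i * (σ 1 - σ 0) := by
    linear_combination apply_eq_apply_zero_of_periodic_one hlin i
  obtain h | h := hσ 0 <;> rw [zero_add] at h
  · exact Or.inl ⟨σ 0, fun i => by rw [hformula, h]; ring⟩
  · exact Or.inr ⟨σ 0, fun i => by rw [hformula, h]; ring⟩

end Cycle

section Groups

variable {A : Type*} [Group A]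

theorem normalizer_le_centralizer_of_coprime_factorial {H : Subgroup A} [Finite H]
    [IsMulCommutative H] (h : H.index.Coprime (Nat.card H).factorial) :
    Subgroup.normalizer (H : Set A) ≤ Subgroup.centralizer H := by
  have hdvd_index : (Subgroup.centralizer (H : Set A)).relIndex (Subgroup.normalizer H) ∣ H.index :=
    (Subgroup.relIndex_dvd_of_le_left _ H.le_centralizer).trans
      (Subgroup.relIndex_dvd_index_of_le Subgroup.le_normalizer)
  have hdvd_card : (Subgroup.centralizer (H : Set A)).relIndex (Subgroup.normalizer H) ∣
      Nat.card (MulAut H) := by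
    rw [Subgroup.relIndex, ← Subgroup.normalizerMonoidHom_ker]
    exact Subgroup.card_dvd_of_injective _
      (QuotientGroup.kerLift_injective H.normalizerMonoidHom)
  have hfactorial : Nat.card (MulAut H) ∣ (Nat.card H).factorial := by
    rw [← Nat.card_perm]
    exact Subgroup.card_dvd_of_injective (MulAut.toPerm H) MulEquiv.toEquiv_injective
  exact Subgroup.relIndex_eq_one.1
    (Nat.eq_one_of_dvd_coprimes h hdvd_index (hdvd_card.trans hfactorial))

theorem exists_normal_card_eq_of_card_eq_sq_mul {p m : ℕ} [hp : Fact p.Prime]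
    (hA : Nat.card A = p ^ 2 * m) (hm : m.Coprime (p ^ 2).factorial) :
    ∃ N : Subgroup A, N.Normal ∧ Nat.card N = m := by
  have hp0 : p ^ 2 ≠ 0 := pow_ne_zero 2 hp.out.ne_zero
  have hpm : ¬ p ∣ m := (hp.out.coprime_iff_not_dvd).1 <| Nat.Coprime.symm <|
    hm.coprime_dvd_right <| Nat.dvd_factorial hp.out.pos <| Nat.le_self_pow two_ne_zero p
  have hm0 : m ≠ 0 := fun h => hpm (h ▸ dvd_zero p)
  have : Finite A := Nat.finite_of_card_ne_zero (hA ▸ mul_ne_zero hp0 hm0)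
  obtain ⟨P⟩ : Nonempty (Sylow p A) := inferInstance
  have hP : Nat.card P = p ^ 2 := by
    rw [P.card_eq_multiplicity, hA, Nat.factorization_mul hp0 hm0, Nat.factorization_pow]
    simp [hp.out.factorization_self, Nat.factorization_eq_zero_of_not_dvd hpm]
  have hindex : P.index = m := by
    have := P.card_mul_index
    rw [hA, hP] at this
    exact Nat.eq_of_mul_eq_mul_left (Nat.pos_of_ne_zero hp0) this
  have : IsMulCommutative P := IsPGroup.isMulCommutative_of_card_eq_prime_sq hP
  have hnormalizer := normalizer_le_centralizer_of_coprime_factorial (H := (P : Subgroup A))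
    (by rwa [hindex, hP])
  refine ⟨(MonoidHom.transferSylow P hnormalizer).ker, inferInstance, ?_⟩
  rw [← hindex, (MonoidHom.ker_transferSylow_isComplement' P hnormalizer).index_eq_card]

section DihedralAction

variable {N : Subgroup A} {π : A →* Equiv.Perm (ZMod n)}

theorem injOn_apply_zero_of_stabilizer_trivial (hstab : ∀ a ∈ N, π a 0 = 0 → a = 1) :
    Set.InjOn (fun a => π a 0) N := by
  intro a ha b hb (h : π a 0 = π b 0)
  refine inv_mul_eq_one.1 (hstab _ (N.mul_mem (N.inv_mem ha) hb) ?_)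
  rw [map_mul, Equiv.Perm.mul_apply, ← h, map_inv, Equiv.Perm.inv_eq_iff_eq]

theorem exists_mem_forall_apply_eq_add_one (hn : Odd n) (hN : Nat.card N = n)
    (hπ : ∀ a ∈ N, IsDihedral (π a)) (hinj : Set.InjOn (fun a => π a 0) N) :
    ∃ g ∈ N, ∀ i, π g i = i + 1 := by
  have : NeZero n := ⟨hn.pos.ne'⟩
  obtain ⟨⟨g, hgN⟩, hg : π g 0 = 1⟩ : ∃ g : N, π g 0 = 1 :=
    (hinj.injective.bijective_of_nat_card_le
      ((Nat.card_zmod n).trans hN.symm).le).surjective 1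
  refine ⟨g, hgN, fun i => ?_⟩
  obtain ⟨c, hc⟩ | ⟨c, hc⟩ := hπ g hgN
  · rw [hc, add_zero] at hg
    rw [hc, hg, add_comm]
  · have hsq : g ^ 2 = 1 := hinj (N.pow_mem hgN 2) N.one_mem (by simp [pow_two, hc])
    have hone : g = 1 := orderOf_eq_one_iff.1 <|
      Nat.eq_one_of_dvd_coprimes (Nat.coprime_two_left.2 hn) (orderOf_dvd_of_pow_eq_one hsq)
        (hN ▸ N.orderOf_dvd_natCard hgN)
    have hzero : (0 : ZMod n) = 1 := by simpa [hone] using hg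
    simp [hone, ← hzero]

theorem conj_eq_or_eq_inv_of_forall_apply_eq_add_one [hN : N.Normal]
    (hinj : Set.InjOn (fun a => π a 0) N) {g : A} (hgN : g ∈ N) (hg : ∀ i, π g i = i + 1) {a : A}
    (ha : IsDihedral (π a)) : a⁻¹ * g * a = g ∨ a⁻¹ * g * a = g⁻¹ := by
  have hconj : a⁻¹ * g * a ∈ N := by simpa using hN.conj_mem g hgN a⁻¹
  have hcomm : π a (π (a⁻¹ * g * a) 0) = π a 0 + 1 := by
    rw [← hg, ← Equiv.Perm.mul_apply, ← Equiv.Perm.mul_apply, ← map_mul, ← map_mul]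
    congr 2
    group
  obtain ⟨c, hc⟩ | ⟨c, hc⟩ := ha <;> rw [hc, hc] at hcomm
  · refine Or.inl (hinj hconj hgN ?_)
    simp only [hg]
    linear_combination hcomm
  · refine Or.inr (hinj hconj (N.inv_mem hgN) ?_)
    simp only [map_inv, Equiv.Perm.eq_inv_iff_eq, hg]
    linear_combination -hcomm

end DihedralAction

end Groups

section Graphs

variable {V : Type*} {G : SimpleGraph V}

theorem exists_adj_of_maximal_isIndepSet {S : Set V} {v : V}
    (hS : Maximal G.IsIndepSet S) (hv : v ∉ S) : ∃ w ∈ S, G.Adj v w := by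
  by_contra! h
  have hind : G.IsIndepSet (insert v S) :=
    Set.Pairwise.insert hS.prop fun w hw _ => ⟨h w hw, fun hwv => h w hw hwv.symm⟩
  exact hv (hS.le_of_ge hind (Set.subset_insert _ _) (Set.mem_insert _ _))

theorem isClique_commonNeighbors_of_iso {W : Type*} {H : SimpleGraph W}
    (φ : G ≃g H) {v w : V} (h : H.IsClique (H.commonNeighbors (φ v) (φ w))) :
    G.IsClique (G.commonNeighbors v w) := by
  intro s hs t ht hne
  exact φ.map_adj_iff.1 <| h ⟨φ.map_adj_iff.2 hs.1, φ.map_adj_iff.2 hs.2⟩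
    ⟨φ.map_adj_iff.2 ht.1, φ.map_adj_iff.2 ht.2⟩ (φ.injective.ne hne)

variable {A : Type*} [Group A] {S : Set A}

/-- The action of a group on a graph isomorphic to one of its Cayley graphs that corresponds to
left multiplication. -/
def leftTranslation (e : G ≃g SimpleGraph.mulCayley S) : A →* (G ≃g G) where
  toFun a :=
    { toFun := fun v => e.symm (a * e v)
      invFun := fun v => e.symm (a⁻¹ * e v)
      left_inv := fun v => by simp
      right_inv := fun v => by simp
      map_rel_iff' := by simp [e.symm.map_adj_iff, e.map_adj_iff] }
  map_one' := by ext v; simp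
  map_mul' a b := by ext v; simp [mul_assoc]

theorem leftTranslation_apply (e : G ≃g SimpleGraph.mulCayley S) (a : A) (v : V) :
    leftTranslation e a v = e.symm (a * e v) := rfl

theorem adj_leftTranslation_iff_of_conj (e : G ≃g SimpleGraph.mulCayley S) {g : A}
    (hg : ∀ a, a⁻¹ * g * a = g ∨ a⁻¹ * g * a = g⁻¹) (v w : V) :
    G.Adj v (leftTranslation e g v) ↔ G.Adj w (leftTranslation e g w) := by
  have hS (u : V) : G.Adj u (leftTranslation e g u) ↔ 1 ≠ g ∧ (g ∈ S ∨ g⁻¹ ∈ S) := by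
    have hinv : (g * e u)⁻¹ * e u = ((e u)⁻¹ * g * e u)⁻¹ := by group
    rw [← e.map_adj_iff, leftTranslation_apply, e.apply_symm_apply, SimpleGraph.mulCayley_adj,
      hinv, ← mul_assoc, ne_eq, right_eq_mul, eq_comm]
    obtain h | h := hg (e u)
    · rw [h]
    · rw [h, inv_inv, or_comm]
  rw [hS, hS]

end Graphs

theorem natCard_vertices (n : ℕ) : Nat.card (ZMod n × ZMod 2 × ZMod 2) = 4 * n := by
  simp [Nat.card_prod, mul_comm]

section Adjacency

variable {v w : ZMod n × ZMod 2 × ZMod 2}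

theorem Q_adj : (Q n).Adj v w ↔ v ≠ w ∧ (w.1 = v.1 ∨
    (w.1 = v.1 + 1 ∧ w.2.1 = v.2.2) ∨ (v.1 = w.1 + 1 ∧ v.2.1 = w.2.2)) := by
  obtain ⟨i, x, y⟩ := v
  obtain ⟨j, u, z⟩ := w
  simp only [Q, PX, SimpleGraph.sup_adj, SimpleGraph.fromRel_adj, ← and_or_left]
  refine and_congr_right fun hne => ⟨?_, ?_⟩
  · rintro ((⟨_, _, _, _, h, h'⟩ | ⟨_, _, _, _, h, h'⟩) |
      (⟨_, _, _, -, h, h'⟩ | ⟨_, _, _, -, h, h'⟩)) <;> cases h <;> cases h' <;> simp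
  · rintro (rfl | ⟨rfl, rfl⟩ | ⟨rfl, rfl⟩)
    · exact Or.inr (Or.inl ⟨_, _, _, fun h => hne (congrArg _ h), rfl, rfl⟩)
    · exact Or.inl (Or.inl ⟨_, _, _, _, rfl, rfl⟩)
    · exact Or.inl (Or.inr ⟨_, _, _, _, rfl, rfl⟩)

theorem fst_eq_add_one_or_sub_one_of_adj (h : (Q n).Adj v w) (hne : v.1 ≠ w.1) :
    w.1 = v.1 + 1 ∨ w.1 = v.1 - 1 := by
  obtain ⟨-, h | h | h⟩ := Q_adj.1 h
  · exact absurd h.symm hne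
  · exact Or.inl h.1
  · exact Or.inr (eq_sub_of_add_eq h.1.symm)

theorem adj_iff_of_fst_eq_add_one (hn : 3 ≤ n) (h : w.1 = v.1 + 1) :
    (Q n).Adj v w ↔ w.2.1 = v.2.2 := by
  have : Nontrivial (ZMod n) := ZMod.nontrivial_iff.2 (by lia)
  have h2 : v.1 ≠ v.1 + 1 + 1 := fun h' => two_ne_zero_zmod hn (by linear_combination -h')
  have hvw : v ≠ w := by
    rintro rfl
    simp at h
  simp [Q_adj, h, h2, hvw]

end Adjacency

/-- The vertices of `Q n` with first coordinate `i`. -/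
def fiber (i : ZMod n) : Set (ZMod n × ZMod 2 × ZMod 2) :=
  {i} ×ˢ Set.univ

/-- The vertices `(i, x, y)` and `(i + 1, y, z)` of `Q n`, for fixed `i` and `y`: together with the
fibers, these are the maximal cliques of `Q n` for `4 ≤ n`. -/
def junction (i : ZMod n) (y : ZMod 2) : Set (ZMod n × ZMod 2 × ZMod 2) :=
  {i} ×ˢ Set.univ ×ˢ {y} ∪ {i + 1} ×ˢ {y} ×ˢ Set.univ

section Cliques

variable {v w : ZMod n × ZMod 2 × ZMod 2} {K : Set (ZMod n × ZMod 2 × ZMod 2)}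

theorem mem_fiber {i : ZMod n} : v ∈ fiber i ↔ v.1 = i := by
  simp [fiber]

theorem mem_junction {i : ZMod n} {y : ZMod 2} :
    v ∈ junction i y ↔ (v.1 = i ∧ v.2.2 = y) ∨ (v.1 = i + 1 ∧ v.2.1 = y) := by
  simp [junction]

theorem ncard_fiber (i : ZMod n) : (fiber i).ncard = 4 := by
  simp [fiber, Set.ncard_prod, Set.ncard_univ]

theorem ncard_junction_le (i : ZMod n) (y : ZMod 2) : (junction i y).ncard ≤ 4 := by
  refine (Set.ncard_union_le _ _).trans ?_
  simp [Set.ncard_prod, Set.ncard_univ]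

theorem isClique_fiber (i : ZMod n) : (Q n).IsClique (fiber i) := by
  intro v hv w hw hne
  rw [mem_fiber] at hv hw
  exact Q_adj.2 ⟨hne, Or.inl (hw.trans hv.symm)⟩

theorem isClique_junction (i : ZMod n) (y : ZMod 2) : (Q n).IsClique (junction i y) := by
  intro v hv w hw hne
  rw [mem_junction] at hv hw
  grind [Q_adj]

theorem commonNeighbors_subset_junction (hn : 4 ≤ n) (i : ZMod n) (x y z : ZMod 2) :
    (Q n).commonNeighbors (i, x, y) (i + 1, y, z) ⊆ junction i y := by
  rintro ⟨j, a, b⟩ ⟨hv, hw⟩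
  have h2 := two_ne_zero_zmod (n := n) (by lia)
  have h3 := three_ne_zero_zmod hn
  simp only [SimpleGraph.mem_neighborSet, Q_adj] at hv hw
  rw [mem_junction]
  grind

theorem exists_mem_junction_of_adj (hn : 4 ≤ n) (h : (Q n).Adj v w) (hne : v.1 ≠ w.1) :
    ∃ i y, v ∈ junction i y ∧ w ∈ junction i y ∧ (Q n).commonNeighbors v w ⊆ junction i y := by
  obtain ⟨i, x, y⟩ := v
  obtain ⟨j, a, b⟩ := w
  have hcases := (Q_adj.1 h).2
  dsimp only at hcases hne
  obtain h | ⟨rfl, rfl⟩ | ⟨rfl, rfl⟩ := hcases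
  · exact absurd h.symm hne
  · exact ⟨i, a, by simp [mem_junction], by simp [mem_junction],
      commonNeighbors_subset_junction hn i x a b⟩
  · rw [SimpleGraph.commonNeighbors_symm]
    exact ⟨j, x, by simp [mem_junction], by simp [mem_junction],
      commonNeighbors_subset_junction hn j a x y⟩

theorem isClique_commonNeighbors (hn : 4 ≤ n) (h : (Q n).Adj v w) (hne : v.1 ≠ w.1) :
    (Q n).IsClique ((Q n).commonNeighbors v w) := by
  obtain ⟨i, y, -, -, hsub⟩ := exists_mem_junction_of_adj hn h hne
  exact (isClique_junction i y).subset hsub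

theorem subset_fiber_or_subset_junction (hn : 4 ≤ n) (hK : (Q n).IsClique K) :
    (∃ i, K ⊆ fiber i) ∨ ∃ i y, K ⊆ junction i y := by
  by_cases h : ∃ v ∈ K, ∃ w ∈ K, v.1 ≠ w.1
  · obtain ⟨v, hv, w, hw, hne⟩ := h
    obtain ⟨i, y, hvJ, hwJ, hsub⟩ :=
      exists_mem_junction_of_adj hn (hK hv hw (ne_of_apply_ne Prod.fst hne)) hne
    refine Or.inr ⟨i, y, fun s hs => ?_⟩
    by_cases hsv : v = s
    · exact hsv ▸ hvJ
    by_cases hsw : w = s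
    · exact hsw ▸ hwJ
    exact hsub ⟨hK hv hs hsv, hK hw hs hsw⟩
  · push Not at h
    left
    obtain rfl | ⟨v, hv⟩ := K.eq_empty_or_nonempty
    · exact ⟨0, Set.empty_subset _⟩
    · exact ⟨v.1, fun w hw => mem_fiber.2 (h w hw v hv)⟩

theorem cliqueNum_Q (hn : 4 ≤ n) : (Q n).cliqueNum = 4 := by
  have : NeZero n := ⟨by lia⟩
  apply le_antisymm
  · obtain ⟨s, hs⟩ := (Q n).exists_isNClique_cliqueNum
    rw [← hs.card_eq, ← Set.ncard_coe_finset]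
    obtain ⟨i, h⟩ | ⟨i, y, h⟩ := subset_fiber_or_subset_junction hn hs.isClique
    · exact (Set.ncard_le_ncard h).trans (ncard_fiber i).le
    · exact (Set.ncard_le_ncard h).trans (ncard_junction_le i y)
  · rw [← ncard_fiber (0 : ZMod n), Set.ncard_eq_toFinset_card _ (Set.toFinite _)]
    apply SimpleGraph.IsClique.card_le_cliqueNum
    simpa using isClique_fiber 0

end Cliques

section StableSets

variable {S : Set (ZMod n × ZMod 2 × ZMod 2)}

theorem injOn_fst_of_isIndepSet (hS : (Q n).IsIndepSet S) : Set.InjOn Prod.fst S := by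
  intro v hv w hw h
  by_contra hne
  exact hS hv hw hne (Q_adj.2 ⟨hne, Or.inl h.symm⟩)

theorem indepNum_Q [NeZero n] : (Q n).indepNum = n := by
  apply le_antisymm
  · obtain ⟨s, hs⟩ := (Q n).exists_isNIndepSet_indepNum
    calc (Q n).indepNum = s.card := hs.card_eq.symm
      _ ≤ (Finset.univ : Finset (ZMod n)).card :=
        Finset.card_le_card_of_injOn Prod.fst (by simp) (injOn_fst_of_isIndepSet hs.isIndepSet)
      _ = n := by simp
  · let s : Finset (ZMod n × ZMod 2 × ZMod 2) := Finset.univ ×ˢ {(0, 1)}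
    have hs : (Q n).IsIndepSet s := by
      rintro ⟨i, p⟩ hv ⟨j, q⟩ hw -
      obtain rfl : (0, 1) = p := by simpa [s] using hv
      obtain rfl : (0, 1) = q := by simpa [s] using hw
      simp [Q_adj, eq_comm]
    calc n = s.card := by simp [s]
      _ ≤ (Q n).indepNum := hs.card_le_indepNum

theorem exists_forall_mem_fiber_apply_ne (hS : (Q n).IsIndepSet S) (i : ZMod n)
    (f : ZMod n × ZMod 2 × ZMod 2 → ZMod 2) : ∃ x, ∀ v ∈ S, v.1 = i → f v ≠ x := by
  by_cases h : ∃ v ∈ S, v.1 = i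
  · obtain ⟨v, hv, hvi⟩ := h
    refine ⟨f v + 1, fun w hw hwi => ?_⟩
    simp [injOn_fst_of_isIndepSet hS hw hv (hwi.trans hvi.symm)]
  · push Not at h
    exact ⟨0, fun v hv hvi => absurd hvi (h v hv)⟩

theorem inter_fiber_nonempty (hS : Maximal (Q n).IsIndepSet S) (i : ZMod n) :
    (fiber i ∩ S).Nonempty := by
  obtain ⟨x, hx⟩ := exists_forall_mem_fiber_apply_ne hS.prop (i - 1) fun v => v.2.2
  obtain ⟨y, hy⟩ := exists_forall_mem_fiber_apply_ne hS.prop (i + 1) fun v => v.2.1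
  by_cases hv : (i, x, y) ∈ S
  · exact ⟨_, mem_fiber.2 rfl, hv⟩
  obtain ⟨w, hw, hadj⟩ := exists_adj_of_maximal_isIndepSet hS hv
  obtain ⟨-, h | h | h⟩ := Q_adj.1 hadj
  · exact ⟨w, mem_fiber.2 h, hw⟩
  · exact absurd h.2 (hy w hw h.1)
  · exact absurd h.2.symm (hx w hw (eq_sub_of_add_eq h.1.symm))

theorem inter_junction_nonempty [Nontrivial (ZMod n)] (hS : Maximal (Q n).IsIndepSet S)
    (i : ZMod n) (y : ZMod 2) : (junction i y ∩ S).Nonempty := by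
  obtain ⟨v, hv, hvS⟩ := inter_fiber_nonempty hS i
  obtain ⟨w, hw, hwS⟩ := inter_fiber_nonempty hS (i + 1)
  rw [mem_fiber] at hv hw
  have hvw : v ≠ w := by
    rintro rfl
    simp [hv] at hw
  have hne : w.2.1 ≠ v.2.2 := fun h =>
    hS.prop hvS hwS hvw (Q_adj.2 ⟨hvw, Or.inr (Or.inl ⟨by rw [hv, hw], h⟩)⟩)
  obtain h | h : v.2.2 = y ∨ w.2.1 = y :=
    (by decide : ∀ a b y : ZMod 2, b ≠ a → a = y ∨ b = y) _ _ y hne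
  · exact ⟨v, mem_junction.2 (Or.inl ⟨hv, h⟩), hvS⟩
  · exact ⟨w, mem_junction.2 (Or.inr ⟨hw, h⟩), hwS⟩

theorem isCIS_Q (hn : 4 ≤ n) : IsCIS (Q n) := by
  have : Nontrivial (ZMod n) := ZMod.nontrivial_iff.2 (by lia)
  intro C S hC hS
  obtain ⟨i, h⟩ | ⟨i, y, h⟩ := subset_fiber_or_subset_junction hn hC.prop
  · rw [hC.eq_of_subset (isClique_fiber i) h]
    exact inter_fiber_nonempty hS i
  · rw [hC.eq_of_subset (isClique_junction i y) h]
    exact inter_junction_nonempty hS i y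

end StableSets

theorem reachable_of_fst_eq {v w : ZMod n × ZMod 2 × ZMod 2} (h : v.1 = w.1) :
    (Q n).Reachable v w := by
  obtain rfl | hne := eq_or_ne v w
  · rfl
  · exact (isClique_fiber w.1 (mem_fiber.2 h) (mem_fiber.2 rfl) hne).reachable

theorem connected_Q : (Q n).Connected := by
  have hstep : Function.Periodic
      (fun i : ZMod n => (Q n).connectedComponentMk (i, 0, 0)) 1 := fun i => by
    apply SimpleGraph.ConnectedComponent.sound
    obtain h | hne := eq_or_ne (i + 1) i
    · exact reachable_of_fst_eq h
    · exact (Q_adj.2 ⟨by simpa using hne, by simp⟩ : (Q n).Adj _ _).reachable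
  have hzero (v : ZMod n × ZMod 2 × ZMod 2) : (Q n).Reachable v (0, 0, 0) :=
    (reachable_of_fst_eq (v := v) (w := (v.1, 0, 0)) rfl).trans <|
      SimpleGraph.ConnectedComponent.exact (apply_eq_apply_zero_of_periodic_one hstep v.1)
  exact ⟨fun v w => (hzero v).trans (hzero w).symm⟩

theorem neighborSet_Q [Nontrivial (ZMod n)] (i : ZMod n) (x y : ZMod 2) :
    (Q n).neighborSet (i, x, y) = fiber i \ {(i, x, y)} ∪
      ({i + 1} ×ˢ {y} ×ˢ Set.univ ∪ {i - 1} ×ˢ Set.univ ×ˢ {x}) := by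
  ext ⟨j, a, b⟩
  have h1 : (1 : ZMod n) ≠ 0 := one_ne_zero
  simp only [SimpleGraph.mem_neighborSet, Q_adj, Set.mem_union, Set.mem_sdiff, mem_fiber,
    Set.mem_prod, Set.mem_singleton_iff, Set.mem_univ]
  grind

theorem hasValency_Q (hn : 3 ≤ n) : HasValency (Q n) 7 := by
  have : NeZero n := ⟨by lia⟩
  have : Nontrivial (ZMod n) := ZMod.nontrivial_iff.2 (by lia)
  rintro ⟨i, x, y⟩
  have hsub : i + 1 ≠ i - 1 := fun h => two_ne_zero_zmod hn (by linear_combination h)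
  have hdisj : Disjoint (fiber i \ {(i, x, y)})
      ({i + 1} ×ˢ {y} ×ˢ Set.univ ∪ {i - 1} ×ˢ Set.univ ×ˢ {x}) := by
    refine Disjoint.mono_left Set.sdiff_subset ?_
    simp [fiber, Set.disjoint_prod, eq_comm (a := i)]
  have hdisj' : Disjoint ({i + 1} ×ˢ ({y} : Set (ZMod 2)) ×ˢ (Set.univ : Set (ZMod 2)))
      ({i - 1} ×ˢ Set.univ ×ˢ {x}) := by
    simp [Set.disjoint_prod, hsub]
  rw [neighborSet_Q, Set.ncard_union_eq hdisj, Set.ncard_union_eq hdisj',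
    Set.ncard_sdiff_singleton_of_mem (a := (i, x, y)) (s := fiber i) (mem_fiber.2 rfl), ncard_fiber]
  simp [Set.ncard_prod, Set.ncard_univ]

section Automorphisms

/-- The automorphism of `Q n` that rotates the fibers by `k` and flips the two bits at the
positions where `f` is nonzero, `x` being the bit at position `i` of a vertex `(i, x, y)` and `y`
its bit at position `i + 1`. -/
def rotateFlip (k : ZMod n) (f : ZMod n → ZMod 2) : Q n ≃g Q n where
  toFun v := (v.1 + k, v.2.1 + f v.1, v.2.2 + f (v.1 + 1))
  invFun v := (v.1 - k, v.2.1 - f (v.1 - k), v.2.2 - f (v.1 - k + 1))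
  left_inv := by rintro ⟨i, x, y⟩; simp
  right_inv := by rintro ⟨i, x, y⟩; simp
  map_rel_iff' {v w} := by
    rw [Q_adj, Q_adj, (Equiv.injective _).ne_iff]
    simp only [Equiv.coe_fn_mk, add_right_comm _ k 1, add_left_inj]
    refine and_congr_right' (or_congr_right (or_congr ?_ ?_)) <;>
      exact and_congr_right fun h => by rw [h, add_left_inj]

/-- The automorphism `(i, x, y) ↦ (-i, y, x)` of `Q n`. -/
def reversal (n : ℕ) : Q n ≃g Q n where
  toFun v := (-v.1, v.2.2, v.2.1)
  invFun v := (-v.1, v.2.2, v.2.1)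
  left_inv v := by simp
  right_inv v := by simp
  map_rel_iff' {v w} := by
    rw [Q_adj, Q_adj, (Equiv.injective _).ne_iff]
    simp only [Equiv.coe_fn_mk]
    grind

theorem isVertexTransitive_Q [Nontrivial (ZMod n)] : IsVertexTransitive (Q n) := by
  rintro ⟨i, x, y⟩ ⟨j, a, b⟩
  refine ⟨rotateFlip (j - i) (Function.update (fun _ => b - y) i (a - x)), ?_⟩
  simp [rotateFlip]

theorem not_isClique_commonNeighbors (hn : 3 ≤ n) (i : ZMod n) (x y y' : ZMod 2) :
    ¬ (Q n).IsClique ((Q n).commonNeighbors (i, x, y) (i, x, y')) := by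
  have : Nontrivial (ZMod n) := ZMod.nontrivial_iff.2 (by lia)
  intro h
  have hs : (i, x + 1, y) ∈ (Q n).commonNeighbors (i, x, y) (i, x, y') := by
    simp [SimpleGraph.mem_commonNeighbors, Q_adj]
  have ht : (i - 1, 0, x) ∈ (Q n).commonNeighbors (i, x, y) (i, x, y') := by
    simp [SimpleGraph.mem_commonNeighbors, Q_adj, eq_comm (a := i)]
  have hts : (Q n).Adj (i - 1, 0, x) (i, x + 1, y) := h ht hs (by simp)
  rw [adj_iff_of_fst_eq_add_one hn (by simp)] at hts
  simp at hts

/- The common neighbors of `(i, x, y)` and `(i, x + 1, y + 1)` do form a clique, like those of an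
edge between two fibers, but the other edges inside a fiber already connect it. -/
theorem fst_apply_eq_of_fst_eq (hn : 4 ≤ n) (φ : Q n ≃g Q n) {v w : ZMod n × ZMod 2 × ZMod 2}
    (h : v.1 = w.1) : (φ v).1 = (φ w).1 := by
  have hright (φ : Q n ≃g Q n) (i : ZMod n) (x y y' : ZMod 2) :
      (φ (i, x, y)).1 = (φ (i, x, y')).1 := by
    by_contra hne
    have hy : y ≠ y' := by
      rintro rfl
      exact hne rfl
    have hadj : (Q n).Adj (φ (i, x, y)) (φ (i, x, y')) :=
      φ.map_adj_iff.2 (Q_adj.2 ⟨by simpa using hy, Or.inl rfl⟩)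
    exact not_isClique_commonNeighbors (by lia) i x y y'
      (isClique_commonNeighbors_of_iso φ (isClique_commonNeighbors hn hadj hne))
  have hleft (i : ZMod n) (x x' y : ZMod 2) : (φ (i, x, y)).1 = (φ (i, x', y)).1 := by
    simpa [reversal] using hright ((reversal n).trans φ) (-i) y x x'
  obtain ⟨i, x, y⟩ := v
  obtain ⟨j, x', y'⟩ := w
  obtain rfl : i = j := h
  exact (hright φ i x y y').trans (hleft i x x' y')

/-- The action of the automorphisms of `Q n` on the set of fibers. -/
def fiberPerm (hn : 4 ≤ n) : (Q n ≃g Q n) →* Equiv.Perm (ZMod n) :=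
  MonoidHom.toHomPerm
    { toFun := fun φ i => (φ (i, 0, 0)).1
      map_one' := rfl
      map_mul' := fun φ ψ => funext fun _ =>
        fst_apply_eq_of_fst_eq hn φ (w := ((ψ _).1, 0, 0)) rfl }

theorem fiberPerm_fst (hn : 4 ≤ n) (φ : Q n ≃g Q n) (v : ZMod n × ZMod 2 × ZMod 2) :
    fiberPerm hn φ v.1 = (φ v).1 :=
  fst_apply_eq_of_fst_eq hn φ rfl

theorem isDihedral_fiberPerm (hn : 4 ≤ n) (φ : Q n ≃g Q n) : IsDihedral (fiberPerm hn φ) := by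
  have : Nontrivial (ZMod n) := ZMod.nontrivial_iff.2 (by lia)
  refine isDihedral_of_apply_add_one fun i => ?_
  refine fst_eq_add_one_or_sub_one_of_adj (v := φ (i, 0, 0)) (w := φ (i + 1, 0, 0)) ?_ ?_
  · exact φ.map_adj_iff.2 (Q_adj.2 (by simp))
  · rw [← fiberPerm_fst hn, ← fiberPerm_fst hn]
    exact (fiberPerm hn φ).injective.ne (by simp)

theorem exists_adj_apply_and_not_adj_apply (hn : 3 ≤ n) (φ : Q n ≃g Q n)
    (hφ : ∀ v, (φ v).1 = v.1 + 1) : ∃ v w, (Q n).Adj v (φ v) ∧ ¬ (Q n).Adj w (φ w) := by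
  set c := (φ (-1, 0, 0)).2.2
  have hadj (y : ZMod 2) : (Q n).Adj (0, 0, y) (φ (0, 0, y)) ↔ c = y := by
    have h : (Q n).Adj (φ (-1, 0, 0)) (φ (0, 0, y)) :=
      φ.map_adj_iff.2 ((adj_iff_of_fst_eq_add_one hn (by simp)).2 rfl)
    rw [adj_iff_of_fst_eq_add_one hn (by simp [hφ])] at h
    rw [adj_iff_of_fst_eq_add_one hn (hφ _), h]
  exact ⟨(0, 0, c), (0, 0, c + 1), (hadj c).2 rfl, by simp [hadj]⟩

end Automorphisms

section NotCayley

theorem orderOf_dvd_four_of_fiberPerm_leftTranslation (hn : 4 ≤ n) {A : Type*} [Group A]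
    {S : Set A} (e : Q n ≃g SimpleGraph.mulCayley S) {a : A}
    (ha : fiberPerm hn (leftTranslation e a) 0 = 0) : orderOf a ∣ 4 := by
  let B : Subgroup A := (MulAction.stabilizer (Equiv.Perm (ZMod n)) (0 : ZMod n)).comap
    ((fiberPerm hn).comp (leftTranslation e))
  let orbitEquiv : A ≃ ZMod n × ZMod 2 × ZMod 2 :=
    (Equiv.mulRight (e (0, 0, 0))).trans e.symm.toEquiv
  have hmem (b : A) : b ∈ B ↔ orbitEquiv b ∈ fiber 0 := by
    rw [mem_fiber]
    exact Iff.rfl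
  have hB : Nat.card B = 4 := by
    rw [← ncard_fiber (0 : ZMod n)]
    exact Nat.card_congr (orbitEquiv.subtypeEquiv hmem)
  exact hB ▸ B.orderOf_dvd_natCard ha

theorem isEmpty_iso_mulCayley (hn : 4 ≤ n) (h6 : n.Coprime 6) {A : Type*} [Group A] (S : Set A) :
    IsEmpty (Q n ≃g SimpleGraph.mulCayley S) := by
  refine ⟨fun e => ?_⟩
  have hA : Nat.card A = 4 * n := by
    rw [← Nat.card_congr e.toEquiv, natCard_vertices]
  obtain ⟨N, _, hN⟩ := exists_normal_card_eq_of_card_eq_sq_mul (p := 2) hA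
    ((h6.pow_right 3).coprime_dvd_right (by decide))
  let π : A →* Equiv.Perm (ZMod n) := (fiberPerm hn).comp (leftTranslation e)
  have hodd : n.Coprime 2 := h6.coprime_dvd_right (by norm_num)
  have hinj : Set.InjOn (fun a => π a 0) N :=
    injOn_apply_zero_of_stabilizer_trivial fun a haN ha => orderOf_eq_one_iff.1 <|
      Nat.eq_one_of_dvd_coprimes (hodd.pow_right 2) (hN ▸ N.orderOf_dvd_natCard haN)
        (orderOf_dvd_four_of_fiberPerm_leftTranslation hn e ha)
  have hdihedral (a : A) : IsDihedral (π a) := isDihedral_fiberPerm hn _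
  obtain ⟨g, hgN, hg⟩ := exists_mem_forall_apply_eq_add_one (Nat.coprime_two_right.1 hodd) hN
    (fun a _ => hdihedral a) hinj
  obtain ⟨v, w, hv, hw⟩ := exists_adj_apply_and_not_adj_apply (by lia) (leftTranslation e g)
    fun v => (fiberPerm_fst hn _ v).symm.trans (hg v.1)
  exact hw ((adj_leftTranslation_iff_of_conj e
    (fun a => conj_eq_or_eq_inv_of_forall_apply_eq_add_one hinj hgN hg (hdihedral a)) v w).1 hv)

end NotCayley

end CISGraphs

theorem mainTheorem5_general (n : ℕ) (hn : 4 ≤ n) :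
    (CISGraphs.Q n).Connected ∧
    CISGraphs.IsVertexTransitive (CISGraphs.Q n) ∧
    CISGraphs.IsCIS (CISGraphs.Q n) ∧
    Nat.card (ZMod n × ZMod 2 × ZMod 2) = 4 * n ∧
    CISGraphs.HasValency (CISGraphs.Q n) 7 ∧
    (CISGraphs.Q n).indepNum = n ∧
    (CISGraphs.Q n).cliqueNum = 4 ∧
    (n.Coprime 6 → ¬ CISGraphs.IsCayley (CISGraphs.Q n)) := by
  have : NeZero n := ⟨by lia⟩
  have : Nontrivial (ZMod n) := ZMod.nontrivial_iff.2 (by lia)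
  exact ⟨CISGraphs.connected_Q, CISGraphs.isVertexTransitive_Q, CISGraphs.isCIS_Q hn,
    CISGraphs.natCard_vertices n, CISGraphs.hasValency_Q (by lia), CISGraphs.indepNum_Q,
    CISGraphs.cliqueNum_Q hn,
    fun h6 ⟨_, _, S, _, _, ⟨e⟩⟩ => (CISGraphs.isEmpty_iso_mulCayley hn h6 S).false e⟩

theorem mainTheorem5 (n : ℕ) (hn : 4 ≤ n) :
    (CISGraphs.Q n).Connected ∧
    CISGraphs.IsVertexTransitive (CISGraphs.Q n) ∧
    CISGraphs.IsCIS (CISGraphs.Q n) ∧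
    Nat.card (ZMod n × ZMod 2 × ZMod 2) = 4 * n ∧
    CISGraphs.HasValency (CISGraphs.Q n) 7 ∧
    (CISGraphs.Q n).indepNum = n ∧
    (CISGraphs.Q n).cliqueNum = 4 ∧
    (n.Prime → ¬ CISGraphs.IsCayley (CISGraphs.Q n)) := by
  obtain ⟨h₁, h₂, h₃, h₄, h₅, h₆, h₇, hCayley⟩ := mainTheorem5_general n hn
  exact ⟨h₁, h₂, h₃, h₄, h₅, h₆, h₇, fun hp => hCayley (CISGraphs.coprime_six_of_prime hn hp)⟩
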